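/- Let $G$ be a unimodular locally compact second countable Hausdorff group and let $\mathcal H$ be a separable complex Hilbert space with scalar product linear in the second argument. Let $U$ be a projective representation of $G$ in $\mathcal H$: a weakly Borel map from $G$ into the unitary operators on $\mathcal H$ with $U(e)=I$ and $U(gh)=\mathtt m(g,h)\,U(g)U(h)$ for some Borel function $\mathtt m\colon G\times G\to\mathbb T$. For $\psi,\phi\in\mathcal H$ set $c_{\psi,\phi}(g)=\langle U(g)\psi,\phi\rangle$, and let $\mathcal A(U)$ be the set of all $\psi\in\mathcal H$ such that $c_{\psi,\phi}\in L^2(G)$ (with respect to left Haar measure) for some $\phi\neq0$. Suppose that $U$ is square integrable, i.e. irreducible (with $\mathcal H\ne 0$) and $\mathcal A(U)\neq\{0\}$. Given a left Haar measure $\mu$, a Duflo–Moore operator of $U$ normalized according to $\mu$ is a positive selfadjoint injective operator $D$ with domain $\mathcal A(U)$ such that, for all $\psi_1,\psi_2\in\mathcal A(U)$ and $\phi_1,\phi_2\in\mathcal H$, the coefficients $c_{\psi_i,\phi_i}$ are in $L^2(G,\mu)$ and $\int_G \overline{c_{\psi_1,\phi_1}}\,c_{\psi_2,\phi_2}\,d\mu=\langle\phi_1,\phi_2\rangle\langle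 D\psi_2,D\psi_1\rangle$; the measure $\mu$ is said to be normalized in agreement with $U$ if $D=I$ is such an operator. There is exactly one Haar measure $\mu_G$ on $G$ normalized in agreement with $U$. Let $\mathcal B_2(\mathcal H)$ be the Hilbert space of Hilbert–Schmidt operators on $\mathcal H$, with scalar product $\langle A,B\rangle_{HS}=\operatorname{tr}(A^*B)$, and for $T\in\mathcal B_2(\mathcal H)$ put $T(g_1,g_2)=U(g_1)\,T\,U(g_2)^*$. Then: 1. For all $A,T\in\mathcal B_2(\mathcal H)$ the function $D_TA\colon (g_1,g_2)\mapsto\langle T(g_1,g_2),A\rangle_{HS}$ is Borel and belongs to $L^2(G\times G)=L^2(G\times G,\mu_G\otimes\mu_G)$. 2. For every $T\in\mathcal B_2(\mathcal H)$ the map $D_T\colon\mathcal B_2(\mathcal H)\to L^2(G\times G)$, $A\mapsto D_TA$, is linear, and if $\|T\|_{HS}=1$ it is an isometry. 3. If $\|T\|_{HS}=1$, the family $\{T(g_1,g_2)\}_{(g_1,g_2)\in G\times G}$ is a normalized tight frame in $\mathcal B_2(\mathcal H)$ based on $(G\times G,\mu_G\otimes\mu_G)$, i.e. all the functions $D_TA$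 are in $L^2(G\times G)$ and $\int_{G\times G}|D_TA|^2\,d(\mu_G\otimes\mu_G)=\|A\|_{HS}^2$ for all $A\in\mathcal B_2(\mathcal H)$. 4. For all $A,B,S,T\in\mathcal B_2(\mathcal H)$ the function $\overline{D_TA}\,D_SB$ is integrable on $G\times G$ and $$\int_{G\times G}\overline{(D_TA)(g_1,g_2)}\,(D_SB)(g_1,g_2)\,d(\mu_G\otimes\mu_G)(g_1,g_2)=\langle A,B\rangle_{HS}\,\langle S,T\rangle_{HS}.$$ -/

import Mathlib

open MeasureTheory
open scoped ENNReal InnerProductSpace ComplexConjugate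

/-! ### Hilbert-Schmidt operators -/

section HilbertSchmidt

variable (H : Type*) [NormedAddCommGroup H] [InnerProductSpace ℂ H] [CompleteSpace H]

/-- The index set of a fixed orthonormal (Hilbert) basis of `H`. -/
def stdIndex : Set H := (exists_hilbertBasis ℂ H).choose

/-- A fixed orthonormal (Hilbert) basis of `H`. -/
noncomputable def stdBasis : HilbertBasis (stdIndex H) ℂ H :=
  (exists_hilbertBasis ℂ H).choose_spec.choose

variable {H}

/-- The trace `∑ᵢ ⟪eᵢ, A eᵢ⟫` of an operator, computed in the fixed orthonormal basis. It is used
below only for products `A† B` of Hilbert-Schmidt operators, where the series converges absolutely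
and its sum does not depend on the basis (see `HilbertSchmidt.hasSum_inner`). -/
noncomputable def opTrace (A : H →L[ℂ] H) : ℂ :=
  ∑' i, ⟪stdBasis H i, A (stdBasis H i)⟫_ℂ

/-- `A` is Hilbert-Schmidt: `∑ᵢ ‖A eᵢ‖² < ∞`. This does not depend on the orthonormal basis
(see `isHilbertSchmidt_iff`). -/
def IsHilbertSchmidt (A : H →L[ℂ] H) : Prop :=
  Summable fun i => ‖A (stdBasis H i)‖ ^ 2

theorem HilbertBasis.tsum_enorm_sq {ι : Type*} (b : HilbertBasis ι ℂ H) (x : H) :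
    ∑' i, ‖⟪b i, x⟫_ℂ‖ₑ ^ 2 = ‖x‖ₑ ^ 2 := by
  have h := b.hasSum_inner_mul_inner x x
  have h2 : HasSum (fun i => ‖⟪b i, x⟫_ℂ‖ ^ 2) (‖x‖ ^ 2) := by
    have h3 := Complex.hasSum_re h
    rw [inner_self_eq_norm_sq_to_K] at h3
    convert! h3 using 1
    · ext i
      rw [← inner_conj_symm x (b i), Complex.conj_mul']
      norm_cast
    · simp [← Complex.ofReal_pow]
  have h4 := ENNReal.ofReal_tsum_of_nonneg (fun i => sq_nonneg ‖⟪b i, x⟫_ℂ‖) h2.summable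
  rw [h2.tsum_eq] at h4
  simpa [ENNReal.ofReal_pow, ofReal_norm] using h4.symm

theorem tsum_enorm_sq_adjoint {ι κ : Type*} (b : HilbertBasis ι ℂ H) (c : HilbertBasis κ ℂ H)
    (A : H →L[ℂ] H) :
    ∑' i, ‖A (b i)‖ₑ ^ 2 = ∑' j, ‖(ContinuousLinearMap.adjoint A) (c j)‖ₑ ^ 2 := by
  rw [tsum_congr fun i => (c.tsum_enorm_sq (A (b i))).symm,
    tsum_congr fun j => (b.tsum_enorm_sq (ContinuousLinearMap.adjoint A (c j))).symm]
  rw [ENNReal.tsum_comm]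
  refine tsum_congr fun j => tsum_congr fun i => ?_
  rw [ContinuousLinearMap.adjoint_inner_right, ← inner_conj_symm, RCLike.enorm_conj]

theorem summable_sq_iff {ι : Type*} (f : ι → H) :
    Summable (fun i => ‖f i‖ ^ 2) ↔ ∑' i, ‖f i‖ₑ ^ 2 ≠ ∞ := by
  have h : ∀ i, ‖f i‖ₑ ^ 2 = ENNReal.ofReal (‖f i‖ ^ 2) := fun i => by
    rw [ENNReal.ofReal_pow (norm_nonneg _), ofReal_norm]
  simp_rw [h]
  exact ⟨fun hs => hs.tsum_ofReal_ne_top, fun hs => by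
    simpa [ENNReal.toReal_ofReal, sq_nonneg] using ENNReal.summable_toReal hs⟩

theorem isHilbertSchmidt_iff {ι : Type*} (b : HilbertBasis ι ℂ H) (A : H →L[ℂ] H) :
    IsHilbertSchmidt A ↔ Summable fun i => ‖A (b i)‖ ^ 2 := by
  rw [IsHilbertSchmidt, summable_sq_iff, summable_sq_iff,
    tsum_enorm_sq_adjoint _ (stdBasis H), tsum_enorm_sq_adjoint b (stdBasis H)]

theorem IsHilbertSchmidt.adjoint {A : H →L[ℂ] H} (hA : IsHilbertSchmidt A) :
    IsHilbertSchmidt (ContinuousLinearMap.adjoint A) := by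
  rw [IsHilbertSchmidt, summable_sq_iff] at *
  rwa [← tsum_enorm_sq_adjoint (stdBasis H)]

theorem IsHilbertSchmidt.comp_left {A : H →L[ℂ] H} (hA : IsHilbertSchmidt A) (B : H →L[ℂ] H) :
    IsHilbertSchmidt (B * A) := by
  refine Summable.of_nonneg_of_le (fun i => sq_nonneg _) (fun i => ?_) (hA.mul_left (‖B‖ ^ 2))
  rw [← mul_pow]
  exact pow_le_pow_left₀ (norm_nonneg _) (B.le_opNorm _) 2

theorem IsHilbertSchmidt.comp_right {A : H →L[ℂ] H} (hA : IsHilbertSchmidt A) (B : H →L[ℂ] H) :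
    IsHilbertSchmidt (A * B) := by
  have h := (hA.adjoint.comp_left (star B)).adjoint
  rw [← ContinuousLinearMap.star_eq_adjoint, ← ContinuousLinearMap.star_eq_adjoint] at h
  simpa using h

variable (H) in
/-- The Hilbert-Schmidt operators as a linear subspace of the bounded operators. -/
noncomputable def hilbertSchmidtSubmodule : Submodule ℂ (H →L[ℂ] H) where
  carrier := {A | IsHilbertSchmidt A}
  zero_mem' := by simp [IsHilbertSchmidt, summable_zero]
  add_mem' := by
    intro A B hA hB
    refine Summable.of_nonneg_of_le (fun i => sq_nonneg _) (fun i => ?_)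
      ((hA.add hB).mul_left 2)
    have h := norm_add_le (A (stdBasis H i)) (B (stdBasis H i))
    have h' := pow_le_pow_left₀ (norm_nonneg _) h 2
    rw [add_apply]
    nlinarith [sq_nonneg (‖A (stdBasis H i)‖ - ‖B (stdBasis H i)‖)]
  smul_mem' := by
    intro c A hA
    have h := hA.mul_left (‖c‖ ^ 2)
    simpa [IsHilbertSchmidt, norm_smul, mul_pow] using h

variable (H) in
/-- The space `B₂(H)` of Hilbert-Schmidt operators on `H`. It is a type of its own, so that it
carries the Hilbert-Schmidt norm and not the operator norm. -/
def HilbertSchmidt : Type _ := hilbertSchmidtSubmodule H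

namespace HilbertSchmidt

noncomputable instance : AddCommGroup (HilbertSchmidt H) :=
  inferInstanceAs (AddCommGroup (hilbertSchmidtSubmodule H))

noncomputable instance : Module ℂ (HilbertSchmidt H) :=
  inferInstanceAs (Module ℂ (hilbertSchmidtSubmodule H))

/-- The underlying bounded operator. -/
def op (A : HilbertSchmidt H) : H →L[ℂ] H := A.1

/-- The Hilbert-Schmidt scalar product `⟨A, B⟩ = tr(A† B)`. -/
noncomputable def hsInner (A B : HilbertSchmidt H) : ℂ :=
  opTrace (ContinuousLinearMap.adjoint A.op * B.op)

theorem isHilbertSchmidt (A : HilbertSchmidt H) : IsHilbertSchmidt A.op := A.2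

theorem op_add (A B : HilbertSchmidt H) : (A + B).op = A.op + B.op := rfl

theorem op_smul (c : ℂ) (A : HilbertSchmidt H) : (c • A).op = c • A.op := rfl

theorem hsInner_eq (A B : HilbertSchmidt H) :
    hsInner A B = ∑' i, ⟪A.op (stdBasis H i), B.op (stdBasis H i)⟫_ℂ := by
  simp [hsInner, opTrace, ContinuousLinearMap.adjoint_inner_right]

theorem summable_inner {ι : Type*} (b : HilbertBasis ι ℂ H) (A B : HilbertSchmidt H) :
    Summable fun i => ⟪A.op (b i), B.op (b i)⟫_ℂ := by
  refine Summable.of_norm_bounded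
    (((isHilbertSchmidt_iff b _).1 A.2).add ((isHilbertSchmidt_iff b _).1 B.2)) (fun i => ?_)
  have h := norm_inner_le_norm (𝕜 := ℂ) (A.op (b i)) (B.op (b i))
  change _ ≤ ‖A.op (b i)‖ ^ 2 + ‖B.op (b i)‖ ^ 2
  nlinarith [sq_nonneg (‖A.op (b i)‖ - ‖B.op (b i)‖), sq_nonneg (‖A.op (b i)‖),
    sq_nonneg (‖B.op (b i)‖)]

theorem hsInner_self (A : HilbertSchmidt H) :
    hsInner A A = ((∑' i, ‖A.op (stdBasis H i)‖ ^ 2 : ℝ) : ℂ) := by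
  rw [hsInner_eq, Complex.ofReal_tsum]
  refine tsum_congr fun i => ?_
  rw [inner_self_eq_norm_sq_to_K]
  simp

/-- `B₂(H)` with the scalar product `tr(A† B)`. -/
noncomputable abbrev core : InnerProductSpace.Core ℂ (HilbertSchmidt H) where
  inner := hsInner
  conj_inner_symm A B := by
    rw [hsInner_eq, hsInner_eq, Complex.conj_tsum]
    exact tsum_congr fun i => inner_conj_symm _ _
  re_inner_nonneg A := by
    rw [hsInner_self]
    exact tsum_nonneg fun i => sq_nonneg _
  add_left A B C := by
    simp only [hsInner_eq]
    rw [← (summable_inner _ A C).tsum_add (summable_inner _ B C)]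
    exact tsum_congr fun i => by rw [op_add, add_apply, inner_add_left]
  smul_left A B c := by
    simp only [hsInner_eq]
    rw [← tsum_mul_left]
    exact tsum_congr fun i => by
      rw [op_smul, smul_apply, inner_smul_left]
  definite A h := by
    rw [hsInner_self, Complex.ofReal_eq_zero] at h
    have h0 := (hasSum_zero_iff_of_nonneg (fun i => sq_nonneg ‖A.op (stdBasis H i)‖)).1
      (h ▸ A.isHilbertSchmidt.hasSum)
    refine Subtype.ext (ContinuousLinearMap.ext_on
      (Submodule.dense_iff_topologicalClosure_eq_top.2 (stdBasis H).dense_span) ?_)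
    rintro _ ⟨i, rfl⟩
    exact norm_eq_zero.1 (pow_eq_zero_iff two_ne_zero |>.1 (congr_fun h0 i))

noncomputable instance : NormedAddCommGroup (HilbertSchmidt H) :=
  (core (H := H)).toNormedAddCommGroup

noncomputable instance : InnerProductSpace ℂ (HilbertSchmidt H) :=
  InnerProductSpace.ofCore (core (H := H)).toCore

theorem inner_def (A B : HilbertSchmidt H) :
    ⟪A, B⟫_ℂ = opTrace (ContinuousLinearMap.adjoint A.op * B.op) := rfl

theorem hasSum_norm_sq {ι : Type*} (b : HilbertBasis ι ℂ H) (A : HilbertSchmidt H) :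
    HasSum (fun i => ‖A.op (b i)‖ ^ 2) (‖A‖ ^ 2) := by
  have h1 : (‖A‖ ^ 2 : ℝ) = ∑' i, ‖A.op (stdBasis H i)‖ ^ 2 := by
    have h : hsInner A A = ((‖A‖ : ℝ) : ℂ) ^ 2 := inner_self_eq_norm_sq_to_K (𝕜 := ℂ) A
    rw [hsInner_self] at h
    exact_mod_cast h.symm
  have h2 : ∑' i, ‖A.op (stdBasis H i)‖ₑ ^ 2 = ∑' i, ‖A.op (b i)‖ₑ ^ 2 := by
    rw [tsum_enorm_sq_adjoint (stdBasis H) (stdBasis H), tsum_enorm_sq_adjoint b (stdBasis H)]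
  have h3 := congrArg ENNReal.toReal h2
  rw [ENNReal.tsum_toReal_eq (fun i => by simp), ENNReal.tsum_toReal_eq (fun i => by simp)] at h3
  simp only [ENNReal.toReal_pow, toReal_enorm] at h3
  rw [h1, h3]
  exact ((isHilbertSchmidt_iff b _).1 A.2).hasSum

/-- The scalar product can be computed in every orthonormal basis. -/
theorem hasSum_inner {ι : Type*} (b : HilbertBasis ι ℂ H) (A B : HilbertSchmidt H) :
    HasSum (fun i => ⟪b i, (ContinuousLinearMap.adjoint A.op * B.op) (b i)⟫_ℂ) ⟪A, B⟫_ℂ := by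
  have h (C : HilbertSchmidt H) :
      HasSum (fun i => ((‖C.op (b i)‖ : ℝ) : ℂ) ^ 2) (((‖C‖ : ℝ) : ℂ) ^ 2) := by
    have := (hasSum_norm_sq b C).mapL Complex.ofRealCLM
    simpa using this
  have hn (C : HilbertSchmidt H) : (-C).op = -C.op := rfl
  rw [inner_eq_sum_norm_sq_div_four A B]
  refine ((((h (A + B)).sub (h (A - B))).add (((h (A - (RCLike.I : ℂ) • B)).sub
    (h (A + (RCLike.I : ℂ) • B))).mul_right (RCLike.I : ℂ))).div_const 4).congr_fun fun i => ?_
  rw [mul_apply_eq_comp, ContinuousLinearMap.adjoint_inner_right,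
    inner_eq_sum_norm_sq_div_four (A.op (b i)) (B.op (b i))]
  simp only [sub_eq_add_neg, op_add, hn, op_smul]
  rfl

/-- The Hilbert-Schmidt operator `V T W†`, for unitary `V` and `W`. -/
noncomputable def conjugate (V W : unitary (H →L[ℂ] H)) (T : HilbertSchmidt H) :
    HilbertSchmidt H :=
  ⟨(V : H →L[ℂ] H) * T.op * ContinuousLinearMap.adjoint (W : H →L[ℂ] H),
    (T.isHilbertSchmidt.comp_left _).comp_right _⟩

end HilbertSchmidt

end HilbertSchmidt

/-! ### Frames based on a measure space -/

/-- The family `(ψ x)` is a frame in `S` based on `(X, μ)`, with frame bounds `α ≤ β`. -/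
structure HasFrameBounds {X S : Type*} [MeasurableSpace X] [NormedAddCommGroup S]
    [InnerProductSpace ℂ S] (μ : Measure X) (ψ : X → S) (α β : ℝ) : Prop where
  pos : 0 < α
  le : α ≤ β
  memLp : ∀ φ : S, MemLp (fun x => ⟪ψ x, φ⟫_ℂ) 2 μ
  lower : ∀ φ : S, α * ‖φ‖ ^ 2 ≤ ∫ x, ‖⟪ψ x, φ⟫_ℂ‖ ^ 2 ∂μ
  upper : ∀ φ : S, ∫ x, ‖⟪ψ x, φ⟫_ℂ‖ ^ 2 ∂μ ≤ β * ‖φ‖ ^ 2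

/-- A normalized tight frame: the frame bounds `α = β = 1` are allowed. -/
def IsNormalizedTightFrame {X S : Type*} [MeasurableSpace X] [NormedAddCommGroup S]
    [InnerProductSpace ℂ S] (μ : Measure X) (ψ : X → S) : Prop :=
  HasFrameBounds μ ψ 1 1

/-! ### Square integrable projective representations -/

/-- A locally compact group is unimodular if its modular function is identically `1`. -/
def IsUnimodularGroup (G : Type*) [TopologicalSpace G] [Group G] [IsTopologicalGroup G]
    [LocallyCompactSpace G] : Prop :=
  ∀ g : G, Measure.modularCharacter g = 1

/-- A (weakly Borel, unitary) projective representation of `G` in `H`. -/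
structure ProjectiveRep (G H : Type*) [Group G] [MeasurableSpace G] [NormedAddCommGroup H]
    [InnerProductSpace ℂ H] [CompleteSpace H] where
  /-- The unitary operator `U(g)`. -/
  toFun : G → unitary (H →L[ℂ] H)
  weaklyBorel : ∀ φ ψ : H, Measurable fun g => ⟪φ, (toFun g : H →L[ℂ] H) ψ⟫_ℂ
  map_one : toFun 1 = 1
  /-- Existence of a Borel multiplier with values in the circle group. -/
  multiplier : ∃ m : G × G → ℂ, Measurable m ∧ (∀ p, ‖m p‖ = 1) ∧
    ∀ g h, (toFun (g * h) : H →L[ℂ] H) =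
      m (g, h) • ((toFun g : H →L[ℂ] H) * (toFun h : H →L[ℂ] H))

namespace ProjectiveRep

variable {G H : Type*} [Group G] [MeasurableSpace G] [NormedAddCommGroup H]
  [InnerProductSpace ℂ H] [CompleteSpace H]

/-- `U` is irreducible: `H ≠ 0`, and the only closed invariant subspaces are `0` and `H`. -/
def IsIrreducible (U : ProjectiveRep G H) : Prop :=
  Nontrivial H ∧ ∀ K : Submodule ℂ H, IsClosed (K : Set H) →
    (∀ g, ∀ x ∈ K, (U.toFun g : H →L[ℂ] H) x ∈ K) → K = ⊥ ∨ K = ⊤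

/-- The coefficient `c_{ψ,φ}(g) = ⟪U(g) ψ, φ⟫`. -/
noncomputable def coeff (U : ProjectiveRep G H) (ψ φ : H) (g : G) : ℂ :=
  ⟪(U.toFun g : H →L[ℂ] H) ψ, φ⟫_ℂ

/-- The set `A(U)` of admissible vectors. -/
def admissible (U : ProjectiveRep G H) (μ : Measure G) : Set H :=
  {ψ | ∃ φ : H, φ ≠ 0 ∧ MemLp (U.coeff ψ φ) 2 μ}

/-- `U` is square integrable: it is irreducible and has a nonzero admissible vector with respect
to left Haar measure (whose normalization is irrelevant here). -/
def IsSquareIntegrable [TopologicalSpace G] [IsTopologicalGroup G] [LocallyCompactSpace G]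
    [BorelSpace G] (U : ProjectiveRep G H) : Prop :=
  U.IsIrreducible ∧ ∃ ψ ∈ U.admissible Measure.haar, ψ ≠ 0

/-- `D` is a Duflo-Moore operator of `U`, normalized according to the left Haar measure `μ`: a
positive selfadjoint injective operator with domain `A(U)` that satisfies the orthogonality
relations. -/
structure IsDufloMooreOperator (U : ProjectiveRep G H) (μ : Measure G) (D : H →ₗ.[ℂ] H) :
    Prop where
  isSelfAdjoint : IsSelfAdjoint D
  nonneg : ∀ x : D.domain, 0 ≤ (⟪(x : H), D x⟫_ℂ).re
  injective : Function.Injective D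
  domain_eq : (D.domain : Set H) = U.admissible μ
  memLp : ∀ (ψ : D.domain) (φ : H), MemLp (U.coeff ψ φ) 2 μ
  orthogonality : ∀ (ψ₁ ψ₂ : D.domain) (φ₁ φ₂ : H),
    ∫ g, conj (U.coeff ψ₁ φ₁ g) * U.coeff ψ₂ φ₂ g ∂μ = ⟪φ₁, φ₂⟫_ℂ * ⟪D ψ₂, D ψ₁⟫_ℂ

/-- `μ` is a Haar measure normalized in agreement with `U`: the identity is the Duflo-Moore
operator of `U` normalized according to `μ`. -/
def NormalizedInAgreement [TopologicalSpace G] (U : ProjectiveRep G H) (μ : Measure G) : Prop :=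
  μ.IsHaarMeasure ∧ U.IsDufloMooreOperator μ ((LinearMap.id : H →ₗ[ℂ] H).toPMap ⊤)

/-- The operator `T(g₁, g₂) = U(g₁) T U(g₂)†`. -/
noncomputable def translate (U : ProjectiveRep G H) (T : HilbertSchmidt H) (p : G × G) :
    HilbertSchmidt H :=
  T.conjugate (U.toFun p.1) (U.toFun p.2)

/-- The function `D_T A : (g₁, g₂) ↦ ⟨T(g₁, g₂), A⟩` on `G × G`. -/
noncomputable def dequant (U : ProjectiveRep G H) (T A : HilbertSchmidt H) (p : G × G) : ℂ :=
  ⟪U.translate T p, A⟫_ℂ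

end ProjectiveRep

/-!
The coefficients of a square integrable irreducible representation `U` of a unimodular group satisfy
`‖c_{ψ,φ}‖² = K ‖ψ‖² ‖φ‖²` in `L²(G)` with a constant `K > 0`, for all vectors `ψ` and `φ`
(`ProjectiveRep.IsSquareIntegrable.exists_orthogonality`). If one coefficient of `ψ` against a
nonzero vector is in `L²`, then the operator `W : φ ↦ c_{ψ,φ}` is closed and intertwines `U` with
left translation up to phases, so its resolvent `(1 + W† W)⁻¹` is a bounded selfadjoint operator
commuting with `U`. By Schur's lemma the resolvent is a scalar, so `W` is everywhere defined and a
multiple of an isometry (`ProjectiveRep.IsIrreducible.exists_integral_norm_sq_coeff`). On a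
unimodular group, Haar measure is invariant under inversion, which exchanges `ψ` and `φ`; hence
every vector is admissible and the multiple is proportional to `‖ψ‖²`. Dividing Haar measure by `K`
gives the unique measure normalized in agreement with `U`.

For this measure, expand `D_T A` in an orthonormal basis `b` as the sum of the functions
`⟪U(g₁) T bᵢ, A U(g₂) bᵢ⟫`. By Tonelli and the relations on `G`, applied in each variable, the
function `⟪U(g₁) u, A U(g₂) v⟫` has norm `‖A‖ ‖u‖ ‖v‖` in `L²(G × G)`
(`ProjectiveRep.lintegral_enorm_sq_matrixCoeff`), so after polarization the terms of the series are
orthogonal with square norms `‖A‖² ‖T bᵢ‖²`, and `‖D_T A‖ = ‖T‖ ‖A‖`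
(`ProjectiveRep.memLp_dequant_and_integral_norm_sq`). A sesquilinear map that multiplies norms
satisfies the full orthogonality relations (`inner_map₂_eq_of_norm_sq`); this yields both the
Duflo-Moore relations on `G` and the relations for `D_T A` on `G × G`.
-/

/-! ### Polarization of sesquilinear maps -/

section Polarization

variable {E F V : Type*} [NormedAddCommGroup E] [InnerProductSpace ℂ E]
  [NormedAddCommGroup F] [InnerProductSpace ℂ F] [NormedAddCommGroup V] [InnerProductSpace ℂ V]

/-- Over `ℂ` a sesquilinear map that vanishes on the diagonal is zero. -/
theorem sesquilinear_eq_zero_of_diag {M : Type*} [AddCommGroup M] [Module ℂ M]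
    (B : M →ₗ⋆[ℂ] M →ₗ[ℂ] ℂ) (h : ∀ x, B x x = 0) (x y : M) : B x y = 0 := by
  have h1 := h (x + y)
  have h2 := h (x + Complex.I • y)
  simp only [map_add, LinearMap.add_apply, map_smul, LinearMap.map_smulₛₗ, LinearMap.smul_apply, h,
    Complex.conj_I, smul_eq_mul] at h1 h2
  have h3 : Complex.I * (B x y - B y x) = 0 := by linear_combination h2
  have h4 := (mul_eq_zero.1 h3).resolve_left Complex.I_ne_zero
  linear_combination (h1 + h4) / 2

/-- A sesquilinear map that multiplies norms, up to a constant, satisfies the orthogonality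
relations: polarize once in each variable. -/
theorem inner_map₂_eq_of_norm_sq (T : E →ₗ⋆[ℂ] F →ₗ[ℂ] V) (K : ℝ)
    (h : ∀ ψ φ, ‖T ψ φ‖ ^ 2 = K * ‖ψ‖ ^ 2 * ‖φ‖ ^ 2) (ψ₁ ψ₂ : E) (φ₁ φ₂ : F) :
    ⟪T ψ₁ φ₁, T ψ₂ φ₂⟫_ℂ = K * ⟪φ₁, φ₂⟫_ℂ * ⟪ψ₂, ψ₁⟫_ℂ := by
  have h1 (ψ : E) (φ₁ φ₂ : F) : ⟪T ψ φ₁, T ψ φ₂⟫_ℂ = K * ‖ψ‖ ^ 2 * ⟪φ₁, φ₂⟫_ℂ := by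
    let B : F →ₗ⋆[ℂ] F →ₗ[ℂ] ℂ := LinearMap.mk₂'ₛₗ (starRingEnd ℂ) (RingHom.id ℂ)
      (fun φ₁ φ₂ => ⟪T ψ φ₁, T ψ φ₂⟫_ℂ - K * ‖ψ‖ ^ 2 * ⟪φ₁, φ₂⟫_ℂ)
      (fun a b c => by simp only [map_add, inner_add_left]; ring)
      (fun c a b => by simp only [map_smul, inner_smul_left, smul_eq_mul]; ring)
      (fun a b c => by simp only [map_add, inner_add_right]; ring)
      (fun c a b => by simp only [map_smul, inner_smul_right, smul_eq_mul, RingHom.id_apply]; ring)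
    refine sub_eq_zero.1 (sesquilinear_eq_zero_of_diag B (fun φ => ?_) φ₁ φ₂)
    change ⟪T ψ φ, T ψ φ⟫_ℂ - K * ‖ψ‖ ^ 2 * ⟪φ, φ⟫_ℂ = 0
    rw [inner_self_eq_norm_sq_to_K, inner_self_eq_norm_sq_to_K, sub_eq_zero]
    simp only [Complex.coe_algebraMap]
    exact_mod_cast h ψ φ
  let B : E →ₗ⋆[ℂ] E →ₗ[ℂ] ℂ := LinearMap.mk₂'ₛₗ (starRingEnd ℂ) (RingHom.id ℂ)
    (fun ψ₂ ψ₁ => ⟪T ψ₁ φ₁, T ψ₂ φ₂⟫_ℂ - K * ⟪φ₁, φ₂⟫_ℂ * ⟪ψ₂, ψ₁⟫_ℂ)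
    (fun a b c => by simp only [map_add, LinearMap.add_apply, inner_add_left, inner_add_right]; ring)
    (fun c a b => by
      simp only [LinearMap.map_smulₛₗ, LinearMap.smul_apply, inner_smul_left, inner_smul_right,
        smul_eq_mul]
      ring)
    (fun a b c => by simp only [map_add, LinearMap.add_apply, inner_add_left, inner_add_right]; ring)
    (fun c a b => by
      simp only [LinearMap.map_smulₛₗ, LinearMap.smul_apply, inner_smul_left, inner_smul_right,
        smul_eq_mul, RingHom.id_apply, Complex.conj_conj]
      ring)
  refine sub_eq_zero.1 (sesquilinear_eq_zero_of_diag B (fun ψ => ?_) ψ₂ ψ₁)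
  change ⟪T ψ φ₁, T ψ φ₂⟫_ℂ - K * ⟪φ₁, φ₂⟫_ℂ * ⟪ψ, ψ⟫_ℂ = 0
  rw [h1, inner_self_eq_norm_sq_to_K]
  simp only [Complex.coe_algebraMap]
  ring

theorem MeasureTheory.MemLp.inner_toLp {X : Type*} [MeasurableSpace X] {μ : Measure X} {f g : X → ℂ}
    (hf : MemLp f 2 μ) (hg : MemLp g 2 μ) :
    ⟪hf.toLp f, hg.toLp g⟫_ℂ = ∫ x, conj (f x) * g x ∂μ := by
  rw [L2.inner_def]
  refine integral_congr_ae ?_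
  filter_upwards [hf.coeFn_toLp, hg.coeFn_toLp] with x h1 h2
  rw [h1, h2, RCLike.inner_apply, mul_comm]

theorem MeasureTheory.MemLp.norm_toLp_sq {X : Type*} [MeasurableSpace X] {μ : Measure X} {f : X → ℂ}
    (hf : MemLp f 2 μ) : ‖hf.toLp f‖ ^ 2 = ∫ x, ‖f x‖ ^ 2 ∂μ := by
  have h := inner_self_eq_norm_sq_to_K (𝕜 := ℂ) (hf.toLp f)
  rw [hf.inner_toLp hf] at h
  simp only [Complex.conj_mul'] at h
  have h2 : ∫ x, (‖f x‖ : ℂ) ^ 2 ∂μ = ((∫ x, ‖f x‖ ^ 2 ∂μ : ℝ) : ℂ) := by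
    rw [← integral_complex_ofReal]
    push_cast
    rfl
  rw [h2] at h
  simp only [Complex.coe_algebraMap] at h
  exact_mod_cast h.symm

theorem MeasureTheory.MemLp.integrable_conj_mul {X : Type*} [MeasurableSpace X] {μ : Measure X}
    {f g : X → ℂ} (hf : MemLp f 2 μ) (hg : MemLp g 2 μ) :
    Integrable (fun x => conj (f x) * g x) μ :=
  hf.star.integrable_mul hg

/-- Orthogonality relations for a family of square integrable functions that is conjugate linear in
the first parameter, linear in the second one, and multiplies norms up to a constant. -/
theorem integral_conj_mul_eq_of_norm_sq {X : Type*} [MeasurableSpace X] {μ : Measure X}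
    (f : E → F → X → ℂ) (hL : ∀ ψ φ, MemLp (f ψ φ) 2 μ) (K : ℝ)
    (add_left : ∀ ψ ψ' φ x, f (ψ + ψ') φ x = f ψ φ x + f ψ' φ x)
    (smul_left : ∀ (c : ℂ) ψ φ x, f (c • ψ) φ x = conj c * f ψ φ x)
    (add_right : ∀ ψ φ φ' x, f ψ (φ + φ') x = f ψ φ x + f ψ φ' x)
    (smul_right : ∀ (c : ℂ) ψ φ x, f ψ (c • φ) x = c * f ψ φ x)
    (h : ∀ ψ φ, ∫ x, ‖f ψ φ x‖ ^ 2 ∂μ = K * ‖ψ‖ ^ 2 * ‖φ‖ ^ 2) (ψ₁ ψ₂ : E) (φ₁ φ₂ : F) :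
    ∫ x, conj (f ψ₁ φ₁ x) * f ψ₂ φ₂ x ∂μ = K * ⟪φ₁, φ₂⟫_ℂ * ⟪ψ₂, ψ₁⟫_ℂ := by
  let T : E →ₗ⋆[ℂ] F →ₗ[ℂ] Lp ℂ 2 μ := LinearMap.mk₂'ₛₗ (starRingEnd ℂ) (RingHom.id ℂ)
    (fun ψ φ => (hL ψ φ).toLp _)
    (fun a b c => by
      rw [← MemLp.toLp_add]
      exact MemLp.toLp_congr _ _ (.of_forall fun x => add_left a b c x))
    (fun c a b => by
      rw [← MemLp.toLp_const_smul]
      exact MemLp.toLp_congr _ _ (.of_forall fun x => smul_left c a b x))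
    (fun a b c => by
      rw [← MemLp.toLp_add]
      exact MemLp.toLp_congr _ _ (.of_forall fun x => add_right a b c x))
    (fun c a b => by
      rw [← MemLp.toLp_const_smul]
      exact MemLp.toLp_congr _ _ (.of_forall fun x => smul_right c a b x))
  rw [← (hL ψ₁ φ₁).inner_toLp (hL ψ₂ φ₂)]
  exact inner_map₂_eq_of_norm_sq T K (fun ψ φ => by rw [← h, ← (hL ψ φ).norm_toLp_sq]; rfl) _ _ _ _

end Polarization

/-! ### Countability of orthonormal families -/

theorem Orthonormal.countable {ι H : Type*} [NormedAddCommGroup H] [InnerProductSpace ℂ H]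
    [TopologicalSpace.SeparableSpace H] {b : ι → H} (hb : Orthonormal ℂ b) : Countable ι := by
  refine Pairwise.countable_of_isOpen_disjoint (s := fun i => Metric.ball (b i) (1 / 2))
    (fun i j hij => ?_) (fun i => Metric.isOpen_ball) (fun i => Metric.nonempty_ball.2 (by norm_num))
  refine Metric.ball_disjoint_ball ?_
  have h := norm_sub_sq (𝕜 := ℂ) (b i) (b j)
  rw [hb.2 hij, hb.1 i, hb.1 j] at h
  rw [dist_eq_norm]
  norm_num at h ⊢
  nlinarith [norm_nonneg (b i - b j)]

/-! ### Haar measure of a unimodular group -/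

section Unimodular

open Measure

variable {G : Type*} [TopologicalSpace G] [Group G] [IsTopologicalGroup G]
    [LocallyCompactSpace G] [SecondCountableTopology G] [MeasurableSpace G] [BorelSpace G]

theorem IsUnimodularGroup.isMulRightInvariant (hG : IsUnimodularGroup G) (μ : Measure G)
    [IsHaarMeasure μ] : IsMulRightInvariant μ where
  map_mul_right_eq_self g := by
    rw [isMulLeftInvariant_eq_smul (map (· * g) μ) μ,
      ← modularCharacterFun_eq_haarScalarFactor μ g]
    have h : modularCharacterFun g = 1 := hG g
    rw [h, one_smul]

theorem IsUnimodularGroup.isInvInvariant (hG : IsUnimodularGroup G) (μ : Measure G)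
    [IsHaarMeasure μ] : IsInvInvariant μ := by
  -- Right invariance makes the image of `μ` under inversion a left invariant measure `c • μ`, and
  -- `c ^ 2 = 1` as inversion is an involution.
  have := hG.isMulRightInvariant μ
  constructor
  let c : ℝ≥0∞ := haarScalarFactor μ.inv μ
  have hc : μ.inv = c • μ := isMulLeftInvariant_eq_smul μ.inv μ
  have : map Inv.inv (map Inv.inv μ) = c ^ 2 • μ := by
    rw [← inv_def μ, hc, Measure.map_smul, ← inv_def μ, hc, smul_smul, pow_two]
  have μeq : μ = c ^ 2 • μ := by
    rw [map_map continuous_inv.measurable continuous_inv.measurable] at this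
    simpa only [inv_involutive, Function.Involutive.comp_self, Measure.map_id]
  have K : TopologicalSpace.PositiveCompacts G := Classical.arbitrary _
  have : c ^ 2 * μ K = 1 ^ 2 * μ K := by
    conv_rhs => rw [μeq]
    simp
  have : c ^ 2 = 1 ^ 2 :=
    (ENNReal.mul_left_inj (measure_pos_of_nonempty_interior _ K.interior_nonempty).ne'
          K.isCompact.measure_lt_top.ne).1 this
  have : c = 1 := (ENNReal.pow_right_strictMono two_ne_zero).injective this
  rw [hc, this, one_smul]

end Unimodular

/-! ### Schur's lemma -/

/-- If a selfadjoint element has two distinct spectral values, then two continuous functions that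
vanish on either side of their midpoint give nonzero functions of it whose product is zero. -/
theorem IsSelfAdjoint.eq_smul_one_or_exists_cfc {A : Type*} [CStarAlgebra A] [Nontrivial A] {a : A}
    (ha : IsSelfAdjoint a) :
    (∃ r : ℝ, a = (r : ℂ) • 1) ∨ ∃ f g : ℝ → ℝ,
      cfc f a ≠ 0 ∧ cfc g a ≠ 0 ∧ cfc f a * cfc g a = 0 := by
  by_cases hs : (spectrum ℝ a).Subsingleton
  · left
    obtain ⟨r, hr⟩ := (ContinuousFunctionalCalculus.spectrum_nonempty (R := ℝ) a ha)
    refine ⟨r, ?_⟩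
    have h1 : cfc (fun x : ℝ => x) a = cfc (fun _ : ℝ => r) a := cfc_congr fun x hx => hs hx hr
    rw [cfc_id' ℝ a, cfc_const r a] at h1
    rw [h1, Algebra.algebraMap_eq_smul_one, Complex.coe_smul]
  · right
    have hs' := Set.not_subsingleton_iff.1 hs
    obtain ⟨s, hs, t, ht, hst⟩ := hs'.exists_lt
    set m := (s + t) / 2
    have nz (f : ℝ → ℝ) (hf : Continuous f) (x : ℝ) (hx : x ∈ spectrum ℝ a) (hfx : f x ≠ 0) :
        cfc f a ≠ 0 := fun h0 => by
      have h1 : f x ∈ spectrum ℝ (cfc f a) := by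
        rw [cfc_map_spectrum f a ha hf.continuousOn]
        exact ⟨x, hx, rfl⟩
      rw [h0, spectrum.zero_eq] at h1
      exact hfx h1
    refine ⟨fun x => max 0 (x - m), fun x => max 0 (m - x), ?_, ?_, ?_⟩
    · refine nz _ (by fun_prop) t ht ?_
      have : 0 < t - m := by simp only [m]; linarith
      exact (lt_max_of_lt_right this).ne'
    · refine nz _ (by fun_prop) s hs ?_
      have : 0 < m - s := by simp only [m]; linarith
      exact (lt_max_of_lt_right this).ne'
    · rw [← cfc_mul _ _ a (by fun_prop) (by fun_prop)]
      rw [← cfc_const_zero ℝ a]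
      refine cfc_congr fun x _ => ?_
      rcases le_total x m with h | h
      · simp [max_eq_left (sub_nonpos.2 h)]
      · simp [max_eq_left (sub_nonpos.2 h)]

namespace ProjectiveRep

/-- Schur's lemma: `ker f(T)` is an invariant subspace for every function `f(T)` of `T`. -/
theorem IsIrreducible.eq_smul_one {G H : Type*} [Group G] [MeasurableSpace G]
    [NormedAddCommGroup H] [InnerProductSpace ℂ H] [CompleteSpace H] {U : ProjectiveRep G H}
    (hU : U.IsIrreducible) {T : H →L[ℂ] H} (hT : IsSelfAdjoint T)
    (hc : ∀ g, Commute T (U.toFun g : H →L[ℂ] H)) : ∃ r : ℝ, T = (r : ℂ) • 1 := by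
  have := hU.1
  rcases hT.eq_smul_one_or_exists_cfc with h | ⟨f, g, hf, hg, hfg⟩
  · exact h
  exfalso
  have hinv (k : G) (x : H) (hx : x ∈ (cfc f T).ker) :
      (U.toFun k : H →L[ℂ] H) x ∈ (cfc f T).ker := by
    have h1 := DFunLike.congr_fun ((hc k).cfc_real f).eq x
    have hx' : cfc f T x = 0 := hx
    change cfc f T ((U.toFun k : H →L[ℂ] H) x) = 0
    rwa [mul_apply_eq_comp, mul_apply_eq_comp, hx', map_zero] at h1
  rcases hU.2 (cfc f T).ker (cfc f T).isClosed_ker hinv with h | h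
  · refine hg (ContinuousLinearMap.ext fun x => ?_)
    have : cfc g T x ∈ (cfc f T).ker := DFunLike.congr_fun hfg x
    rwa [h] at this
  · refine hf (ContinuousLinearMap.ext fun x => ?_)
    have : x ∈ (cfc f T).ker := h ▸ Submodule.mem_top
    exact this

end ProjectiveRep

/-! ### Coefficients of a projective representation -/

namespace ProjectiveRep

section Coefficients

variable {G H : Type*} [Group G] [MeasurableSpace G] [NormedAddCommGroup H]
  [InnerProductSpace ℂ H] [CompleteSpace H] (U : ProjectiveRep G H)

theorem coeff_add_left (ψ ψ' φ : H) (g : G) :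
    U.coeff (ψ + ψ') φ g = U.coeff ψ φ g + U.coeff ψ' φ g := by
  simp [coeff]

theorem coeff_smul_left (c : ℂ) (ψ φ : H) (g : G) :
    U.coeff (c • ψ) φ g = conj c * U.coeff ψ φ g := by
  simp [coeff, mul_comm]

theorem coeff_add_right (ψ φ φ' : H) (g : G) :
    U.coeff ψ (φ + φ') g = U.coeff ψ φ g + U.coeff ψ φ' g := by
  simp [coeff]

theorem coeff_smul_right (c : ℂ) (ψ φ : H) (g : G) :
    U.coeff ψ (c • φ) g = c * U.coeff ψ φ g := by
  simp [coeff]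

theorem measurable_coeff (ψ φ : H) : Measurable (U.coeff ψ φ) := by
  have h : U.coeff ψ φ = fun g => conj ⟪φ, (U.toFun g : H →L[ℂ] H) ψ⟫_ℂ := by
    ext g
    exact (inner_conj_symm _ _).symm
  rw [h]
  exact Complex.continuous_conj.measurable.comp (U.weaklyBorel φ ψ)

theorem inner_apply_apply (g : G) (x y : H) :
    ⟪(U.toFun g : H →L[ℂ] H) x, (U.toFun g : H →L[ℂ] H) y⟫_ℂ = ⟪x, y⟫_ℂ :=
  ContinuousLinearMap.inner_map_map_of_mem_unitary (U.toFun g).2 x y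

theorem surjective_apply (g : G) : Function.Surjective (U.toFun g : H →L[ℂ] H) := fun x =>
  ⟨(star (U.toFun g) : unitary (H →L[ℂ] H)).1 x,
    DFunLike.congr_fun (Unitary.mul_star_self_of_mem (U.toFun g).2) x⟩

/-- Translating the second vector translates the coefficient on the left, up to phases that depend
on neither vector. -/
theorem coeff_apply_right (h : G) : ∃ u : G → ℂ, (∀ g, ‖u g‖ = 1) ∧ ∀ ψ φ g,
    U.coeff ψ ((U.toFun h : H →L[ℂ] H) φ) g = u g * U.coeff ψ φ (h⁻¹ * g) := by
  obtain ⟨m, -, hm, hU⟩ := U.multiplier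
  refine ⟨fun g => conj (m (h, h⁻¹ * g)), fun g => by simp [hm], fun ψ φ g => ?_⟩
  have h1 := hU h (h⁻¹ * g)
  rw [mul_inv_cancel_left] at h1
  rw [coeff, h1, smul_apply, mul_apply_eq_comp, inner_smul_left, inner_apply_apply]
  rfl

/-- Inversion exchanges the two vectors of a coefficient, up to conjugation and phases. -/
theorem coeff_inv : ∃ u : G → ℂ, (∀ g, ‖u g‖ = 1) ∧ ∀ ψ φ g,
    U.coeff ψ φ g⁻¹ = u g * conj (U.coeff φ ψ g) := by
  obtain ⟨m, -, hm, hU⟩ := U.multiplier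
  refine ⟨fun g => m (g, g⁻¹), fun g => hm _, fun ψ φ g => ?_⟩
  have h1 := hU g g⁻¹
  rw [mul_inv_cancel, U.map_one] at h1
  have h2 : ψ = m (g, g⁻¹) •
      (U.toFun g : H →L[ℂ] H) ((U.toFun g⁻¹ : H →L[ℂ] H) ψ) := DFunLike.congr_fun h1 ψ
  have h3 : conj (U.coeff φ ψ g) = conj (m (g, g⁻¹)) * U.coeff ψ φ g⁻¹ := by
    rw [coeff, inner_conj_symm]
    conv_lhs => rw [h2]
    rw [inner_smul_left, inner_apply_apply]
    rfl
  rw [h3, ← mul_assoc, Complex.mul_conj', hm]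
  simp

variable [MeasurableMul G] {μ : Measure G} [μ.IsMulLeftInvariant]

theorem memLp_coeff_apply_iff (ψ φ : H) (h : G) :
    MemLp (U.coeff ψ ((U.toFun h : H →L[ℂ] H) φ)) 2 μ ↔ MemLp (U.coeff ψ φ) 2 μ := by
  obtain ⟨u, hu, hc⟩ := U.coeff_apply_right h
  have hmap := (measurableEmbedding_mulLeft h⁻¹).memLp_map_measure_iff (μ := μ) (p := 2)
    (g := U.coeff ψ φ)
  rw [map_mul_left_eq_self] at hmap
  rw [hmap]
  refine memLp_congr_norm (U.measurable_coeff _ _).aestronglyMeasurable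
    ((U.measurable_coeff _ _).comp (measurable_const_mul _)).aestronglyMeasurable
    (.of_forall fun g => ?_)
  rw [hc, norm_mul, hu, one_mul]
  rfl

theorem integral_coeff_apply (ψ φ φ' : H) (h : G) :
    ∫ g, conj (U.coeff ψ ((U.toFun h : H →L[ℂ] H) φ) g) *
      U.coeff ψ ((U.toFun h : H →L[ℂ] H) φ') g ∂μ =
    ∫ g, conj (U.coeff ψ φ g) * U.coeff ψ φ' g ∂μ := by
  obtain ⟨u, hu, hc⟩ := U.coeff_apply_right h
  rw [← integral_mul_left_eq_self (fun g => conj (U.coeff ψ φ g) * U.coeff ψ φ' g) h⁻¹]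
  refine integral_congr_ae (.of_forall fun g => ?_)
  have h1 : conj (u g) * u g = 1 := by rw [Complex.conj_mul', hu]; simp
  simp only [hc, map_mul]
  linear_combination (conj (U.coeff ψ φ (h⁻¹ * g)) * U.coeff ψ φ' (h⁻¹ * g)) * h1

end Coefficients

/-! ### The coefficient operator of an irreducible representation -/

section CoeffOperator

variable {G H : Type*} [Group G] [MeasurableSpace G] [NormedAddCommGroup H]
  [InnerProductSpace ℂ H] [CompleteSpace H] (U : ProjectiveRep G H) (μ : Measure G)

/-- The graph of the operator `φ ↦ c_{ψ,φ}` from `H` to `L²(G)`, defined where the coefficient is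
square integrable, as a subspace of the Hilbert sum of `H` and `L²(G)`. -/
def coeffGraph (ψ : H) : Submodule ℂ (WithLp 2 (H × Lp ℂ 2 μ)) where
  carrier := {p | p.snd =ᵐ[μ] U.coeff ψ p.fst}
  zero_mem' := by
    change (0 : Lp ℂ 2 μ) =ᵐ[μ] U.coeff ψ 0
    filter_upwards [Lp.coeFn_zero ℂ 2 μ] with g hg
    rw [hg]
    simp [coeff]
  add_mem' {p q} hp hq := by
    change (p.snd + q.snd : Lp ℂ 2 μ) =ᵐ[μ] U.coeff ψ (p.fst + q.fst)
    filter_upwards [Lp.coeFn_add p.snd q.snd, hp, hq] with g hg h1 h2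
    rw [hg, Pi.add_apply, h1, h2, coeff_add_right]
  smul_mem' c p hp := by
    change (c • p.snd : Lp ℂ 2 μ) =ᵐ[μ] U.coeff ψ (c • p.fst)
    filter_upwards [Lp.coeFn_smul c p.snd, hp] with g hg h1
    rw [hg, Pi.smul_apply, h1, coeff_smul_right, smul_eq_mul]

theorem isClosed_coeffGraph (ψ : H) :
    IsClosed (U.coeffGraph μ ψ : Set (WithLp 2 (H × Lp ℂ 2 μ))) := by
  refine IsSeqClosed.isClosed fun p q hp hq => ?_
  have h1 : Filter.Tendsto (fun n => (p n).fst) Filter.atTop (nhds q.fst) :=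
    ((WithLp.fstL 2 ℂ H (Lp ℂ 2 μ)).continuous.tendsto q).comp hq
  have h2 : Filter.Tendsto (fun n => (p n).snd) Filter.atTop (nhds q.snd) :=
    ((WithLp.sndL 2 ℂ H (Lp ℂ 2 μ)).continuous.tendsto q).comp hq
  obtain ⟨ns, hns, h3⟩ := (tendstoInMeasure_of_tendsto_Lp h2).exists_seq_tendsto_ae
  have h4 : ∀ᵐ g ∂μ, ∀ n, (p n).snd g = U.coeff ψ (p n).fst g := ae_all_iff.2 fun n => hp n
  filter_upwards [h3, h4] with g hg hg'
  refine tendsto_nhds_unique hg ?_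
  simp_rw [hg']
  exact Filter.Tendsto.inner tendsto_const_nhds (h1.comp hns.tendsto_atTop)

/-- The resolvent `(1 + W† W)⁻¹` of the operator `W : φ ↦ c_{ψ,φ}`, obtained as `J J†` for the
projection `J` of the graph of `W` to `H`. No density of the domain is needed. -/
theorem exists_resolvent (ψ : H) : ∃ T : H →L[ℂ] H, IsSelfAdjoint T ∧
    ∀ x, MemLp (U.coeff ψ (T x)) 2 μ ∧ ∀ φ, MemLp (U.coeff ψ φ) 2 μ →
      ⟪φ, T x⟫_ℂ + ∫ g, conj (U.coeff ψ φ g) * U.coeff ψ (T x) g ∂μ = ⟪φ, x⟫_ℂ := by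
  have : CompleteSpace (U.coeffGraph μ ψ) := (U.isClosed_coeffGraph μ ψ).completeSpace_coe
  let J : U.coeffGraph μ ψ →L[ℂ] H := (WithLp.fstL 2 ℂ H (Lp ℂ 2 μ)).comp (Submodule.subtypeL _)
  refine ⟨J.comp J.adjoint, ?_, fun x => ?_⟩
  · rw [ContinuousLinearMap.isSelfAdjoint_iff', ContinuousLinearMap.adjoint_comp,
      ContinuousLinearMap.adjoint_adjoint]
  set p := J.adjoint x with hp
  have hp1 : J.comp J.adjoint x = p.1.fst := rfl
  have hp2 : p.1.snd =ᵐ[μ] U.coeff ψ p.1.fst := p.2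
  have hL : MemLp (U.coeff ψ p.1.fst) 2 μ := (memLp_congr_ae hp2).1 (Lp.memLp _)
  rw [hp1]
  refine ⟨hL, fun φ hφ => ?_⟩
  let q : U.coeffGraph μ ψ := ⟨WithLp.toLp 2 (φ, hφ.toLp _), hφ.coeFn_toLp⟩
  have h1 : ⟪q, p⟫_ℂ = ⟪φ, x⟫_ℂ := J.adjoint_inner_right q x
  rw [← h1, Submodule.coe_inner, WithLp.prod_inner_apply, ← hφ.inner_toLp hL]
  congr 2
  exact Lp.ext (hL.coeFn_toLp.trans hp2.symm)

variable {μ}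

variable [MeasurableMul G] [μ.IsMulLeftInvariant]

/-- If one coefficient of `ψ` against a nonzero vector is square integrable, then all of them are,
and `φ ↦ c_{ψ,φ}` is a multiple of an isometry: its resolvent commutes with the representation, so
it is a scalar by Schur's lemma. -/
theorem IsIrreducible.exists_integral_norm_sq_coeff {U : ProjectiveRep G H} (hU : U.IsIrreducible)
    {ψ φ₀ : H} (h0 : φ₀ ≠ 0) (hφ₀ : MemLp (U.coeff ψ φ₀) 2 μ) :
    ∃ k : ℝ, ∀ φ, MemLp (U.coeff ψ φ) 2 μ ∧ ∫ g, ‖U.coeff ψ φ g‖ ^ 2 ∂μ = k * ‖φ‖ ^ 2 := by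
  obtain ⟨T, hT, hL⟩ := U.exists_resolvent μ ψ
  have hcomm (h : G) : Commute T (U.toFun h : H →L[ℂ] H) := by
    refine ContinuousLinearMap.ext fun x => ?_
    rw [mul_apply_eq_comp, mul_apply_eq_comp]
    obtain ⟨hy, hy'⟩ := hL x
    obtain ⟨hz, hz'⟩ := hL ((U.toFun h : H →L[ℂ] H) x)
    set z := T ((U.toFun h : H →L[ℂ] H) x)
    set y := (U.toFun h : H →L[ℂ] H) (T x) with y_def
    have hy1 : MemLp (U.coeff ψ y) 2 μ := (U.memLp_coeff_apply_iff ψ (T x) h).2 hy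
    have hy2 (φ : H) (hφ : MemLp (U.coeff ψ φ) 2 μ) :
        ⟪φ, y⟫_ℂ + ∫ g, conj (U.coeff ψ φ g) * U.coeff ψ y g ∂μ
          = ⟪φ, (U.toFun h : H →L[ℂ] H) x⟫_ℂ := by
      obtain ⟨φ', rfl⟩ := U.surjective_apply h φ
      rw [y_def, inner_apply_apply, inner_apply_apply, integral_coeff_apply]
      exact hy' φ' ((U.memLp_coeff_apply_iff ψ φ' h).1 hφ)
    -- `w = z - y` lies in the domain of `W` and is orthogonal to itself for the graph scalar product
    have hwc : U.coeff ψ (z - y) = U.coeff ψ z - U.coeff ψ y := by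
      ext g
      simp [coeff]
    have hw : MemLp (U.coeff ψ (z - y)) 2 μ := hwc ▸ hz.sub hy1
    have h1 := hz' _ hw
    have h2 := hy2 _ hw
    have h3 : ∫ g, conj (U.coeff ψ (z - y) g) * U.coeff ψ (z - y) g ∂μ =
        ∫ g, conj (U.coeff ψ (z - y) g) * U.coeff ψ z g ∂μ -
        ∫ g, conj (U.coeff ψ (z - y) g) * U.coeff ψ y g ∂μ := by
      rw [← integral_sub (hw.integrable_conj_mul hz) (hw.integrable_conj_mul hy1)]
      refine integral_congr_ae (.of_forall fun g => ?_)
      simp only [hwc, Pi.sub_apply]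
      ring
    have h4 : ⟪z - y, z - y⟫_ℂ + ⟪hw.toLp, hw.toLp⟫_ℂ = 0 := by
      rw [hw.inner_toLp, h3]
      conv_lhs => rw [inner_sub_right]
      linear_combination h1 - h2
    rw [inner_self_eq_norm_sq_to_K, inner_self_eq_norm_sq_to_K] at h4
    simp only [Complex.coe_algebraMap] at h4
    norm_cast at h4
    have h5 : ‖z - y‖ ^ 2 = 0 := by nlinarith [sq_nonneg ‖z - y‖, sq_nonneg ‖hw.toLp‖]
    exact sub_eq_zero.1 (norm_eq_zero.1 (pow_eq_zero_iff two_ne_zero |>.1 h5))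
  obtain ⟨r, hr⟩ := hU.eq_smul_one hT hcomm
  have hTx (x : H) : T x = (r : ℂ) • x := by rw [hr]; rfl
  have hr0 : (r : ℂ) ≠ 0 := fun h => by
    have h1 := (hL φ₀).2 φ₀ hφ₀
    rw [hTx, h, zero_smul] at h1
    simp only [coeff, inner_zero_right, mul_zero, integral_zero, add_zero] at h1
    exact h0 (inner_self_eq_zero.1 h1.symm)
  have hmem (φ : H) : MemLp (U.coeff ψ φ) 2 μ := by
    have h1 := (hL ((r : ℂ)⁻¹ • φ)).1
    rwa [hTx, smul_inv_smul₀ hr0] at h1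
  refine ⟨r⁻¹ - 1, fun φ => ⟨hmem φ, ?_⟩⟩
  have h1 := (hL ((r : ℂ)⁻¹ • φ)).2 φ (hmem φ)
  rw [hTx, smul_inv_smul₀ hr0, ← (hmem φ).inner_toLp (hmem φ), inner_smul_right,
    inner_self_eq_norm_sq_to_K, inner_self_eq_norm_sq_to_K] at h1
  simp only [Complex.coe_algebraMap] at h1
  norm_cast at h1
  rw [(hmem φ).norm_toLp_sq] at h1
  linarith

end CoeffOperator

/-! ### The normalized Haar measure of a unimodular group -/

/-- A Haar measure is normalized in agreement with `U` exactly when all coefficients satisfy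
`‖c_{ψ,φ}‖ = ‖ψ‖ ‖φ‖` in `L²`; the orthogonality relations follow by polarization. -/
theorem normalizedInAgreement_iff {G H : Type*} [TopologicalSpace G] [Group G] [MeasurableSpace G]
    [NormedAddCommGroup H] [InnerProductSpace ℂ H] [CompleteSpace H] [Nontrivial H]
    {U : ProjectiveRep G H} {μ : Measure G} :
    U.NormalizedInAgreement μ ↔ μ.IsHaarMeasure ∧ ∀ ψ φ, MemLp (U.coeff ψ φ) 2 μ ∧
      ∫ g, ‖U.coeff ψ φ g‖ ^ 2 ∂μ = ‖ψ‖ ^ 2 * ‖φ‖ ^ 2 := by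
  refine and_congr_right fun hμ => ⟨fun h ψ φ => ?_, fun h => ?_⟩
  · have hL := h.memLp ⟨ψ, trivial⟩ φ
    refine ⟨hL, ?_⟩
    have h1 := h.orthogonality ⟨ψ, trivial⟩ ⟨ψ, trivial⟩ φ φ
    change ∫ g, conj (U.coeff ψ φ g) * U.coeff ψ φ g ∂μ = ⟪φ, φ⟫_ℂ * ⟪ψ, ψ⟫_ℂ at h1
    rw [← hL.inner_toLp hL, inner_self_eq_norm_sq_to_K, inner_self_eq_norm_sq_to_K,
      inner_self_eq_norm_sq_to_K] at h1
    simp only [Complex.coe_algebraMap] at h1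
    norm_cast at h1
    rw [← hL.norm_toLp_sq, h1, mul_comm]
  · refine ⟨?_, fun x => ?_, fun x y hxy => Subtype.ext hxy, ?_, fun ψ φ => (h ψ φ).1,
      fun ψ₁ ψ₂ φ₁ φ₂ => ?_⟩
    · have h1 := (ContinuousLinearMap.id ℂ H).toPMap_adjoint_eq_adjoint_toPMap_of_dense
        (p := ⊤) (by simp)
      rw [ContinuousLinearMap.adjoint_id] at h1
      exact h1
    · exact inner_self_nonneg (𝕜 := ℂ) (x := (x : H))
    · obtain ⟨φ, hφ⟩ := exists_ne (0 : H)
      exact (Set.eq_univ_of_forall (s := U.admissible μ) fun ψ => ⟨φ, hφ, (h ψ φ).1⟩).symm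
    · have h1 := integral_conj_mul_eq_of_norm_sq U.coeff (fun ψ φ => (h ψ φ).1) 1 U.coeff_add_left
        U.coeff_smul_left U.coeff_add_right U.coeff_smul_right
        (fun ψ φ => by rw [(h ψ φ).2, one_mul]) ψ₁ ψ₂ φ₁ φ₂
      rw [h1, Complex.ofReal_one, one_mul]
      rfl

section Orthogonality

variable {G H : Type*} [TopologicalSpace G] [Group G] [IsTopologicalGroup G]
  [LocallyCompactSpace G] [SecondCountableTopology G] [MeasurableSpace G] [BorelSpace G]
  [NormedAddCommGroup H] [InnerProductSpace ℂ H] [CompleteSpace H]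
  [TopologicalSpace.SeparableSpace H] {U : ProjectiveRep G H}

/-- On a unimodular group inversion exchanges the two vectors of a coefficient without changing
its norm, so the constant of `IsIrreducible.exists_integral_norm_sq_coeff` is proportional to
`‖ψ‖ ^ 2`. -/
theorem IsSquareIntegrable.exists_orthogonality (hG : IsUnimodularGroup G)
    (hU : U.IsSquareIntegrable) : ∃ K : ℝ, 0 < K ∧ ∀ ψ φ,
      MemLp (U.coeff ψ φ) 2 Measure.haar ∧
      ∫ g, ‖U.coeff ψ φ g‖ ^ 2 ∂(Measure.haar : Measure G) = K * ‖ψ‖ ^ 2 * ‖φ‖ ^ 2 := by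
  set μ : Measure G := Measure.haar
  have hinv : μ.IsInvInvariant := hG.isInvInvariant μ
  obtain ⟨hirr, ψ₀, ⟨φ₀, hφ₀, h₀⟩, hψ₀⟩ := hU
  obtain ⟨u, hu, hc⟩ := U.coeff_inv
  have hnorm (ψ φ : H) (g : G) : ‖U.coeff ψ φ g⁻¹‖ = ‖U.coeff φ ψ g‖ := by
    rw [hc, norm_mul, hu, one_mul, RCLike.norm_conj]
  have hswap {ψ φ : H} (h : MemLp (U.coeff ψ φ) 2 μ) : MemLp (U.coeff φ ψ) 2 μ :=
    (h.comp_measurePreserving (Measure.measurePreserving_inv μ)).congr_norm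
      (U.measurable_coeff _ _).aestronglyMeasurable (.of_forall fun g => hnorm ψ φ g)
  have hint (ψ φ : H) : ∫ g, ‖U.coeff ψ φ g‖ ^ 2 ∂μ = ∫ g, ‖U.coeff φ ψ g‖ ^ 2 ∂μ := by
    rw [← integral_inv_eq_self]
    simp_rw [hnorm]
  obtain ⟨k₀, hk₀⟩ := hirr.exists_integral_norm_sq_coeff hφ₀ h₀
  have hall (ψ : H) := hirr.exists_integral_norm_sq_coeff hψ₀ (hswap (hk₀ ψ).1)
  choose k hk using hall
  have hψ₀' : ‖ψ₀‖ ^ 2 ≠ 0 := pow_ne_zero 2 (norm_ne_zero_iff.2 hψ₀)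
  have hkK (ψ : H) : k ψ = k ψ₀ / ‖ψ₀‖ ^ 2 * ‖ψ‖ ^ 2 := by
    have h1 := hint ψ ψ₀
    rw [(hk ψ ψ₀).2, (hk ψ₀ ψ).2] at h1
    field_simp
    exact h1
  refine ⟨k ψ₀ / ‖ψ₀‖ ^ 2, ?_, fun ψ φ => ⟨(hk ψ φ).1, by rw [(hk ψ φ).2, hkK]⟩⟩
  refine div_pos ?_ (by positivity)
  have hnn : 0 ≤ k ψ₀ := by
    have h1 : 0 ≤ ∫ g, ‖U.coeff ψ₀ ψ₀ g‖ ^ 2 ∂μ := integral_nonneg fun g => by positivity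
    rw [(hk ψ₀ ψ₀).2] at h1
    exact nonneg_of_mul_nonneg_left h1 (by positivity)
  refine lt_of_le_of_ne hnn fun h0 => ?_
  -- otherwise `U(g) ψ₀` is orthogonal to a dense sequence for almost every `g`
  have hae (φ : H) : ∀ᵐ g ∂μ, U.coeff ψ₀ φ g = 0 := by
    have h1 := (hk ψ₀ φ).2
    rw [← h0, zero_mul, integral_eq_zero_iff_of_nonneg (fun g => by positivity)
      ((memLp_two_iff_integrable_sq_norm (hk ψ₀ φ).1.1).1 (hk ψ₀ φ).1)] at h1
    filter_upwards [h1] with g hg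
    simpa using hg
  have hae' := ae_all_iff.2 fun n => hae (TopologicalSpace.denseSeq H n)
  obtain ⟨g, hg⟩ := hae'.exists
  have h2 : (fun φ => U.coeff ψ₀ φ g) = fun _ => 0 :=
    Continuous.ext_on (TopologicalSpace.denseRange_denseSeq H)
      (continuous_const.inner continuous_id) continuous_const (by rintro _ ⟨n, rfl⟩; exact hg n)
  have h3 := congr_fun h2 ((U.toFun g : H →L[ℂ] H) ψ₀)
  rw [coeff, inner_apply_apply] at h3
  exact hψ₀ (inner_self_eq_zero.1 h3)

theorem IsSquareIntegrable.existsUnique_normalizedInAgreement (hG : IsUnimodularGroup G)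
    (hU : U.IsSquareIntegrable) : ∃! μ : Measure G, U.NormalizedInAgreement μ := by
  have := hU.1.1
  obtain ⟨K, hK, h⟩ := hU.exists_orthogonality hG
  set μ₀ : Measure G := Measure.haar
  obtain ⟨ψ, hψ⟩ := exists_ne (0 : H)
  have hψ' : ‖ψ‖ ^ 2 * ‖ψ‖ ^ 2 ≠ 0 := by
    have := norm_ne_zero_iff.2 hψ
    positivity
  -- the integral of `|c_{ψ,ψ}|²` against `c • μ₀` determines `c`
  have hsmul (c : ℝ≥0∞) (ψ φ : H) :
      ∫ g, ‖U.coeff ψ φ g‖ ^ 2 ∂(c • μ₀) = c.toReal * (K * ‖ψ‖ ^ 2 * ‖φ‖ ^ 2) := by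
    rw [integral_smul_measure, (h ψ φ).2, smul_eq_mul]
  refine ⟨ENNReal.ofReal K⁻¹ • μ₀, normalizedInAgreement_iff.2
    ⟨Measure.IsHaarMeasure.smul _ (by simpa using hK) ENNReal.ofReal_ne_top, fun ψ φ =>
      ⟨(h ψ φ).1.smul_measure ENNReal.ofReal_ne_top, ?_⟩⟩, fun ν hν => ?_⟩
  · rw [hsmul, ENNReal.toReal_ofReal (by positivity)]
    field_simp
  · obtain ⟨hν1, hν2⟩ := normalizedInAgreement_iff.1 hν
    have hν3 : ν = (Measure.haarScalarFactor ν μ₀ : ℝ≥0∞) • μ₀ :=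
      Measure.isMulLeftInvariant_eq_smul ν μ₀
    have h1 := (hν2 ψ ψ).2
    rw [hν3, hsmul] at h1
    rw [hν3]
    congr 1
    have h2 : (Measure.haarScalarFactor ν μ₀ : ℝ) = K⁻¹ := by
      refine eq_inv_of_mul_eq_one_left ?_
      refine mul_right_cancel₀ hψ' ?_
      rw [ENNReal.coe_toReal] at h1
      linear_combination h1
    rw [← h2, ENNReal.ofReal_coe_nnreal]

end Orthogonality

end ProjectiveRep

/-! ### Hilbert-Schmidt operators and unitary conjugation -/

namespace HilbertSchmidt

variable {H : Type*} [NormedAddCommGroup H] [InnerProductSpace ℂ H] [CompleteSpace H]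

theorem hasSum_inner_op {ι : Type*} (b : HilbertBasis ι ℂ H) (A B : HilbertSchmidt H) :
    HasSum (fun i => ⟪A.op (b i), B.op (b i)⟫_ℂ) ⟪A, B⟫_ℂ := by
  simpa only [mul_apply_eq_comp, ContinuousLinearMap.adjoint_inner_right] using hasSum_inner b A B

theorem tsum_enorm_sq_op {ι : Type*} (b : HilbertBasis ι ℂ H) (A : HilbertSchmidt H) :
    ∑' i, ‖A.op (b i)‖ₑ ^ 2 = ‖A‖ₑ ^ 2 := by
  have h := hasSum_norm_sq b A
  have h4 := ENNReal.ofReal_tsum_of_nonneg (fun i => sq_nonneg ‖A.op (b i)‖) h.summable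
  rw [h.tsum_eq] at h4
  simpa [ENNReal.ofReal_pow, ofReal_norm] using h4.symm

/-- The image of an orthonormal basis under a unitary operator. -/
noncomputable def _root_.HilbertBasis.mapUnitary {ι : Type*} (b : HilbertBasis ι ℂ H)
    (W : unitary (H →L[ℂ] H)) : HilbertBasis ι ℂ H :=
  .ofRepr ((Unitary.linearIsometryEquiv W).symm.trans b.repr)

theorem _root_.HilbertBasis.mapUnitary_apply {ι : Type*} (b : HilbertBasis ι ℂ H)
    (W : unitary (H →L[ℂ] H)) (i : ι) : b.mapUnitary W i = (W : H →L[ℂ] H) (b i) := by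
  classical
  rw [← HilbertBasis.repr_symm_single, ← HilbertBasis.repr_symm_single]
  rfl

theorem op_conjugate_mapUnitary {ι : Type*} (b : HilbertBasis ι ℂ H) (V W : unitary (H →L[ℂ] H))
    (T : HilbertSchmidt H) (i : ι) :
    (T.conjugate V W).op (b.mapUnitary W i) = (V : H →L[ℂ] H) (T.op (b i)) := by
  have h : ContinuousLinearMap.adjoint (W : H →L[ℂ] H) ((W : H →L[ℂ] H) (b i)) = b i :=
    DFunLike.congr_fun (Unitary.star_mul_self_of_mem W.2) (b i)
  rw [b.mapUnitary_apply]
  change (V : H →L[ℂ] H) (T.op (ContinuousLinearMap.adjoint (W : H →L[ℂ] H) _)) = _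
  rw [h]

theorem hasSum_inner_conjugate {ι : Type*} (b : HilbertBasis ι ℂ H) (V W : unitary (H →L[ℂ] H))
    (T A : HilbertSchmidt H) :
    HasSum (fun i => ⟪(V : H →L[ℂ] H) (T.op (b i)), A.op ((W : H →L[ℂ] H) (b i))⟫_ℂ)
      ⟪T.conjugate V W, A⟫_ℂ := by
  have h := hasSum_inner_op (b.mapUnitary W) (T.conjugate V W) A
  simp only [op_conjugate_mapUnitary] at h
  simpa only [b.mapUnitary_apply] using h

theorem conjugate_add (V W : unitary (H →L[ℂ] H)) (S T : HilbertSchmidt H) :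
    (S + T).conjugate V W = S.conjugate V W + T.conjugate V W :=
  Subtype.ext (by
    change (V : H →L[ℂ] H) * (S.op + T.op) * _ =
      (V : H →L[ℂ] H) * S.op * _ + (V : H →L[ℂ] H) * T.op * _
    rw [mul_add, add_mul])

theorem conjugate_smul (V W : unitary (H →L[ℂ] H)) (c : ℂ) (T : HilbertSchmidt H) :
    (c • T).conjugate V W = c • T.conjugate V W :=
  Subtype.ext (by
    change (V : H →L[ℂ] H) * (c • T.op) * _ = c • ((V : H →L[ℂ] H) * T.op * _)
    rw [mul_smul_comm, smul_mul_assoc])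

end HilbertSchmidt

/-! ### Orthogonal series -/

theorem exists_hasSum_of_pairwise_orthogonal {ι V : Type*} [NormedAddCommGroup V]
    [InnerProductSpace ℂ V] [CompleteSpace V] {f : ι → V}
    (h : Pairwise fun i j => ⟪f i, f j⟫_ℂ = 0) {s : ℝ} (hs : HasSum (fun i => ‖f i‖ ^ 2) s) :
    ∃ v, HasSum f v ∧ ‖v‖ ^ 2 = s := by
  have hO : OrthogonalFamily ℂ (fun i => Submodule.span ℂ {f i})
      fun i => (Submodule.span ℂ {f i}).subtypeₗᵢ := by
    intro i j hij v w
    obtain ⟨a, ha⟩ := Submodule.mem_span_singleton.1 v.2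
    obtain ⟨c, hc⟩ := Submodule.mem_span_singleton.1 w.2
    change ⟪(v : V), (w : V)⟫_ℂ = 0
    rw [← ha, ← hc, inner_smul_left,
      inner_smul_right, h hij, mul_zero, mul_zero]
  let l (i : ι) : Submodule.span ℂ {f i} := ⟨f i, Submodule.mem_span_singleton_self _⟩
  obtain ⟨v, hv⟩ := (hO.summable_iff_norm_sq_summable l).2 hs.summable
  refine ⟨v, hv, ?_⟩
  refine tendsto_nhds_unique (((continuous_norm.pow 2).tendsto v).comp hv) ?_
  refine hs.congr fun t => ?_
  exact (hO.norm_sum l t).symm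

/-! ### Orthogonality relations for Hilbert-Schmidt operators -/

namespace ProjectiveRep

section Dequant

variable {G H : Type*} [Group G] [MeasurableSpace G] [NormedAddCommGroup H]
  [InnerProductSpace ℂ H] [CompleteSpace H] (U : ProjectiveRep G H)

theorem dequant_add_left (S T A : HilbertSchmidt H) (p : G × G) :
    U.dequant (S + T) A p = U.dequant S A p + U.dequant T A p := by
  rw [dequant, translate, HilbertSchmidt.conjugate_add, inner_add_left]
  rfl

theorem dequant_smul_left (c : ℂ) (T A : HilbertSchmidt H) (p : G × G) :
    U.dequant (c • T) A p = conj c * U.dequant T A p := by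
  rw [dequant, translate, HilbertSchmidt.conjugate_smul, inner_smul_left]
  rfl

theorem dequant_add_right (T A B : HilbertSchmidt H) (p : G × G) :
    U.dequant T (A + B) p = U.dequant T A p + U.dequant T B p :=
  inner_add_right _ _ _

theorem dequant_smul_right (c : ℂ) (T A : HilbertSchmidt H) (p : G × G) :
    U.dequant T (c • A) p = c * U.dequant T A p :=
  inner_smul_right _ _ _

/-- The function `(g₁, g₂) ↦ ⟪U(g₁) u, A U(g₂) v⟫`, which is `D_T A` for the rank one operator
`T = ⟪v, ·⟫ u`. -/
noncomputable def matrixCoeff (A : HilbertSchmidt H) (u v : H) (p : G × G) : ℂ :=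
  ⟪(U.toFun p.1 : H →L[ℂ] H) u, A.op ((U.toFun p.2 : H →L[ℂ] H) v)⟫_ℂ

theorem hasSum_dequant {ι : Type*} (b : HilbertBasis ι ℂ H) (T A : HilbertSchmidt H) (p : G × G) :
    HasSum (fun i => U.matrixCoeff A (T.op (b i)) (b i) p) (U.dequant T A p) :=
  HilbertSchmidt.hasSum_inner_conjugate b _ _ T A

theorem lintegral_enorm_sq_coeff {U : ProjectiveRep G H} {μ : Measure G}
    (hμ : ∀ ψ φ, MemLp (U.coeff ψ φ) 2 μ ∧
      ∫ g, ‖U.coeff ψ φ g‖ ^ 2 ∂μ = ‖ψ‖ ^ 2 * ‖φ‖ ^ 2) (ψ φ : H) :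
    ∫⁻ g, ‖U.coeff ψ φ g‖ₑ ^ 2 ∂μ = ‖ψ‖ₑ ^ 2 * ‖φ‖ₑ ^ 2 := by
  have h1 := ofReal_integral_eq_lintegral_ofReal
    ((memLp_two_iff_integrable_sq_norm (hμ ψ φ).1.1).1 (hμ ψ φ).1)
    (.of_forall fun g => by positivity)
  rw [(hμ ψ φ).2, ENNReal.ofReal_mul (by positivity)] at h1
  simpa [ENNReal.ofReal_pow, ofReal_norm] using h1.symm

variable [TopologicalSpace.SeparableSpace H]

theorem measurable_matrixCoeff (A : HilbertSchmidt H) (u v : H) :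
    Measurable (U.matrixCoeff A u v) := by
  have := (stdBasis H).orthonormal.countable
  have h (p : G × G) : U.matrixCoeff A u v p = ∑' i, U.coeff u (stdBasis H i) p.1 *
      ⟪ContinuousLinearMap.adjoint A.op (stdBasis H i), (U.toFun p.2 : H →L[ℂ] H) v⟫_ℂ := by
    refine (((stdBasis H).hasSum_inner_mul_inner _ _).tsum_eq.symm).trans (tsum_congr fun i => ?_)
    rw [ContinuousLinearMap.adjoint_inner_left]
    rfl
  rw [funext h]
  exact Measurable.tsum fun i => ((U.measurable_coeff _ _).comp measurable_fst).mul
    ((U.weaklyBorel _ _).comp measurable_snd)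

theorem measurable_dequant (T A : HilbertSchmidt H) : Measurable (U.dequant T A) := by
  have := (stdBasis H).orthonormal.countable
  rw [funext fun p => (U.hasSum_dequant (stdBasis H) T A p).tsum_eq.symm]
  exact Measurable.tsum fun i => U.measurable_matrixCoeff _ _ _

variable {U} {μ : Measure G} [SFinite μ]

/-- Two applications of the orthogonality relations on `G`: for fixed `g₂` the function is the
coefficient `c_{u, A U(g₂) v}`, and expanding `A U(g₂) v` in a basis leaves coefficients of `v`. -/
theorem lintegral_enorm_sq_matrixCoeff (hμ : ∀ ψ φ, MemLp (U.coeff ψ φ) 2 μ ∧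
      ∫ g, ‖U.coeff ψ φ g‖ ^ 2 ∂μ = ‖ψ‖ ^ 2 * ‖φ‖ ^ 2) (A : HilbertSchmidt H) (u v : H) :
    ∫⁻ p, ‖U.matrixCoeff A u v p‖ₑ ^ 2 ∂(μ.prod μ) = ‖A‖ₑ ^ 2 * ‖u‖ₑ ^ 2 * ‖v‖ₑ ^ 2 := by
  have := (stdBasis H).orthonormal.countable
  rw [lintegral_prod_symm' _ ((U.measurable_matrixCoeff A u v).enorm.pow_const 2)]
  have h1 (g₂ : G) : ∫⁻ g₁, ‖U.matrixCoeff A u v (g₁, g₂)‖ₑ ^ 2 ∂μ = ‖u‖ₑ ^ 2 *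
      ∑' i, ‖U.coeff v (ContinuousLinearMap.adjoint A.op (stdBasis H i)) g₂‖ₑ ^ 2 := by
    refine (lintegral_enorm_sq_coeff hμ u (A.op ((U.toFun g₂ : H →L[ℂ] H) v))).trans ?_
    rw [← (stdBasis H).tsum_enorm_sq (A.op _)]
    congr 1
    refine tsum_congr fun i => ?_
    rw [coeff, ContinuousLinearMap.adjoint_inner_right, ← inner_conj_symm, RCLike.enorm_conj]
  simp_rw [h1]
  rw [lintegral_const_mul' _ _ (by simp), lintegral_tsum
    (fun i => ((U.measurable_coeff _ _).enorm.pow_const 2).aemeasurable)]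
  simp only [lintegral_enorm_sq_coeff hμ]
  rw [ENNReal.tsum_mul_left, ← tsum_enorm_sq_adjoint (stdBasis H) (stdBasis H) A.op,
    A.tsum_enorm_sq_op]
  ring

theorem memLp_matrixCoeff (hμ : ∀ ψ φ, MemLp (U.coeff ψ φ) 2 μ ∧
      ∫ g, ‖U.coeff ψ φ g‖ ^ 2 ∂μ = ‖ψ‖ ^ 2 * ‖φ‖ ^ 2) (A : HilbertSchmidt H) (u v : H) :
    MemLp (U.matrixCoeff A u v) 2 (μ.prod μ) := by
  refine ⟨(U.measurable_matrixCoeff A u v).aestronglyMeasurable, ?_⟩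
  rw [eLpNorm_lt_top_iff_lintegral_rpow_enorm_lt_top (by simp) (by simp)]
  simp only [ENNReal.toReal_ofNat, ENNReal.rpow_ofNat, lintegral_enorm_sq_matrixCoeff hμ]
  finiteness

theorem integral_norm_sq_matrixCoeff (hμ : ∀ ψ φ, MemLp (U.coeff ψ φ) 2 μ ∧
      ∫ g, ‖U.coeff ψ φ g‖ ^ 2 ∂μ = ‖ψ‖ ^ 2 * ‖φ‖ ^ 2) (A : HilbertSchmidt H) (u v : H) :
    ∫ p, ‖U.matrixCoeff A u v p‖ ^ 2 ∂(μ.prod μ) = ‖A‖ ^ 2 * ‖u‖ ^ 2 * ‖v‖ ^ 2 := by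
  rw [integral_eq_lintegral_of_nonneg_ae (.of_forall fun p => by positivity)
    ((U.measurable_matrixCoeff A u v).norm.pow_const 2).aestronglyMeasurable]
  simp only [ENNReal.ofReal_pow (norm_nonneg _), ofReal_norm, lintegral_enorm_sq_matrixCoeff hμ]
  simp

theorem integral_conj_matrixCoeff_mul (hμ : ∀ ψ φ, MemLp (U.coeff ψ φ) 2 μ ∧
      ∫ g, ‖U.coeff ψ φ g‖ ^ 2 ∂μ = ‖ψ‖ ^ 2 * ‖φ‖ ^ 2) (A : HilbertSchmidt H) (u u' v v' : H) :
    ∫ p, conj (U.matrixCoeff A u v p) * U.matrixCoeff A u' v' p ∂(μ.prod μ) =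
      ((‖A‖ ^ 2 : ℝ) : ℂ) * ⟪v, v'⟫_ℂ * ⟪u', u⟫_ℂ :=
  integral_conj_mul_eq_of_norm_sq (U.matrixCoeff A) (memLp_matrixCoeff hμ A) _
    (fun _ _ _ _ => by simp only [matrixCoeff, map_add, inner_add_left])
    (fun _ _ _ _ => by simp only [matrixCoeff, map_smul, inner_smul_left])
    (fun _ _ _ _ => by simp only [matrixCoeff, map_add, inner_add_right])
    (fun _ _ _ _ => by simp only [matrixCoeff, map_smul, inner_smul_right])
    (integral_norm_sq_matrixCoeff hμ A) u u' v v'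

/-- In a basis `b` the function `D_T A` is the sum of the functions `⟪U(g₁) T bᵢ, A U(g₂) bᵢ⟫`,
which are orthogonal in `L²(G × G)` and have norms `‖A‖ ‖T bᵢ‖`. -/
theorem memLp_dequant_and_integral_norm_sq (hμ : ∀ ψ φ, MemLp (U.coeff ψ φ) 2 μ ∧
      ∫ g, ‖U.coeff ψ φ g‖ ^ 2 ∂μ = ‖ψ‖ ^ 2 * ‖φ‖ ^ 2) (T A : HilbertSchmidt H) :
    MemLp (U.dequant T A) 2 (μ.prod μ) ∧
      ∫ p, ‖U.dequant T A p‖ ^ 2 ∂(μ.prod μ) = ‖T‖ ^ 2 * ‖A‖ ^ 2 := by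
  have := (stdBasis H).orthonormal.countable
  let b := stdBasis H
  have hF (i) := memLp_matrixCoeff hμ A (T.op (b i)) (b i)
  let F (i : stdIndex H) : Lp ℂ 2 (μ.prod μ) := (hF i).toLp
  have horth : Pairwise fun i j => ⟪F i, F j⟫_ℂ = 0 := fun i j hij => by
    simp only [F]
    rw [(hF i).inner_toLp (hF j), integral_conj_matrixCoeff_mul hμ, b.orthonormal.2 hij]
    simp
  have hsq : HasSum (fun i => ‖F i‖ ^ 2) (‖T‖ ^ 2 * ‖A‖ ^ 2) := by
    refine ((HilbertSchmidt.hasSum_norm_sq b T).mul_right (‖A‖ ^ 2)).congr_fun fun i => ?_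
    simp only [F]
    rw [(hF i).norm_toLp_sq, integral_norm_sq_matrixCoeff hμ, b.orthonormal.1 i]
    ring
  obtain ⟨f, hf, hnorm⟩ := exists_hasSum_of_pairwise_orthogonal horth hsq
  -- the `L²` sum agrees almost everywhere with the pointwise sum
  obtain ⟨ns, hns, h3⟩ := (tendstoInMeasure_of_tendsto_Lp hf).exists_seq_tendsto_ae'
  have h4 : ∀ᵐ p ∂(μ.prod μ), ∀ s : Finset (stdIndex H),
      (∑ i ∈ s, F i : Lp ℂ 2 (μ.prod μ)) p = ∑ i ∈ s, U.matrixCoeff A (T.op (b i)) (b i) p := by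
    refine ae_all_iff.2 fun s => ?_
    have h5 : ∀ᵐ p ∂(μ.prod μ), ∀ i, F i p = U.matrixCoeff A (T.op (b i)) (b i) p :=
      ae_all_iff.2 fun i => (hF i).coeFn_toLp
    filter_upwards [Lp.coeFn_finsetSum s F, h5] with p hp hp'
    rw [hp, Finset.sum_apply]
    exact Finset.sum_congr rfl fun i _ => hp' i
  have hae : U.dequant T A =ᵐ[μ.prod μ] f := by
    filter_upwards [h3, h4] with p hp hp'
    simp_rw [hp'] at hp
    exact tendsto_nhds_unique ((U.hasSum_dequant b T A p).comp hns) hp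
  have hL : MemLp (U.dequant T A) 2 (μ.prod μ) := (memLp_congr_ae hae).2 (Lp.memLp f)
  refine ⟨hL, ?_⟩
  rw [← hL.norm_toLp_sq, ← hnorm]
  congr 2
  exact Lp.ext (hL.coeFn_toLp.trans hae)

end Dequant

end ProjectiveRep

/-! ### Frames of translates of a Hilbert-Schmidt operator -/

theorem theorem1 {G H : Type*} [TopologicalSpace G] [Group G] [IsTopologicalGroup G]
    [LocallyCompactSpace G] [SecondCountableTopology G] [T2Space G]
    [MeasurableSpace G] [BorelSpace G]
    [NormedAddCommGroup H] [InnerProductSpace ℂ H] [CompleteSpace H]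
    [TopologicalSpace.SeparableSpace H]
    (hG : IsUnimodularGroup G) (U : ProjectiveRep G H) (hU : U.IsSquareIntegrable) :
    (∃! μ : Measure G, U.NormalizedInAgreement μ) ∧
    ∀ μ : Measure G, U.NormalizedInAgreement μ →
      (∀ T A : HilbertSchmidt H,
        Measurable (U.dequant T A) ∧ MemLp (U.dequant T A) 2 (μ.prod μ)) ∧
      (∀ T : HilbertSchmidt H, ∃ D : HilbertSchmidt H →ₗ[ℂ] Lp ℂ 2 (μ.prod μ),
        (∀ A, D A =ᵐ[μ.prod μ] U.dequant T A) ∧ (‖T‖ = 1 → Isometry D)) ∧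
      (∀ T : HilbertSchmidt H, ‖T‖ = 1 →
        IsNormalizedTightFrame (μ.prod μ) (U.translate T)) ∧
      (∀ A B S T : HilbertSchmidt H,
        Integrable (fun p => conj (U.dequant T A p) * U.dequant S B p) (μ.prod μ) ∧
        ∫ p, conj (U.dequant T A p) * U.dequant S B p ∂(μ.prod μ) =
          ⟪A, B⟫_ℂ * ⟪S, T⟫_ℂ) := by
  have := hU.1.1
  refine ⟨hU.existsUnique_normalizedInAgreement hG, fun μ hμ => ?_⟩
  obtain ⟨hHaar, hc⟩ := ProjectiveRep.normalizedInAgreement_iff.1 hμ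
  have hL (T A : HilbertSchmidt H) : MemLp (U.dequant T A) 2 (μ.prod μ) :=
    (ProjectiveRep.memLp_dequant_and_integral_norm_sq hc T A).1
  have hn (T A : HilbertSchmidt H) :
      ∫ p, ‖U.dequant T A p‖ ^ 2 ∂(μ.prod μ) = ‖T‖ ^ 2 * ‖A‖ ^ 2 :=
    (ProjectiveRep.memLp_dequant_and_integral_norm_sq hc T A).2
  refine ⟨fun T A => ⟨U.measurable_dequant T A, hL T A⟩, fun T => ?_, fun T hT => ?_,
    fun A B S T => ⟨(hL T A).integrable_conj_mul (hL S B), ?_⟩⟩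
  · let D : HilbertSchmidt H →ₗ[ℂ] Lp ℂ 2 (μ.prod μ) :=
      { toFun A := (hL T A).toLp
        map_add' A B := by
          rw [← MemLp.toLp_add]
          exact MemLp.toLp_congr _ _ (.of_forall fun p => U.dequant_add_right T A B p)
        map_smul' c A := by
          rw [RingHom.id_apply, ← MemLp.toLp_const_smul]
          exact MemLp.toLp_congr _ _ (.of_forall fun p => U.dequant_smul_right c T A p) }
    refine ⟨D, fun A => (hL T A).coeFn_toLp, fun hT => ?_⟩
    refine AddMonoidHomClass.isometry_of_norm D fun A => ?_
    have h1 : ‖D A‖ ^ 2 = ‖A‖ ^ 2 := by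
      change ‖(hL T A).toLp‖ ^ 2 = _
      rw [(hL T A).norm_toLp_sq, hn, hT]
      ring
    exact (sq_eq_sq₀ (norm_nonneg _) (norm_nonneg _)).1 h1
  · have h1 (A : HilbertSchmidt H) :
        ∫ p, ‖⟪U.translate T p, A⟫_ℂ‖ ^ 2 ∂(μ.prod μ) = 1 * ‖A‖ ^ 2 := by
      refine (hn T A).trans ?_
      rw [hT, one_pow]
    exact ⟨one_pos, le_rfl, hL T, fun A => (h1 A).ge, fun A => (h1 A).le⟩
  · rw [integral_conj_mul_eq_of_norm_sq U.dequant hL 1 U.dequant_add_left U.dequant_smul_left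
      U.dequant_add_right U.dequant_smul_right (fun T A => by rw [hn, one_mul]) T S A B,
      Complex.ofReal_one, one_mul]
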